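/- For an infinite word $u=u_0u_1u_2\cdots$ over a finite alphabet $\mathcal A$, let $\mathcal L(u)$ be the set of its finite factors (including the empty word) and let $C(n)$ be the number of factors of length $n$. If $j<k$ are successive occurrences in $u$ of a factor $w$, then $u_ju_{j+1}\cdots u_{k-1}$ is called a return word of $w$; $u$ satisfies $R_m$ if every factor of $u$ has exactly $m$ return words. A factor $w$ is weak bispecial if $$\#\{awb\in\mathcal L(u)\mid a,b\in\mathcal A\}-\#\{a\in\mathcal A\mid aw\in\mathcal L(u)\}-\#\{b\in\mathcal A\mid wb\in\mathcal L(u)\}+1<0.$$ Proposition. Let $\sigma$ be the substitution on $\{1,2,3,4\}$ given by $$1\mapsto 13231,\quad 2\mapsto 13231424131,\quad 3\mapsto 42324131424,\quad 4\mapsto 42324.$$ There is exactly one infinite word $u=\sigma^\infty(1)$ over $\{1,2,3,4\}$ that begins with the letter $1$ and satisfies $\sigma(u)=u$. This word $u$ satisfies $R_4$, its number $C(n)$ of factors of length $n$ is even for every $n\ge1$, and it has infinitely many weak bispecial factors. In particular, it is not true that $C(n)=3n+1$ for all $n\ge0$. Consequently, $R_m$ does not force complexity $(m-1)n+1$: it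 is not true that, for every $m\in\mathbb N$, every infinite word over a finite alphabet satisfying $R_m$ has $C(n)=(m-1)n+1$ for all $n\ge0$. -/

import Mathlib

namespace ReturnWords

section General

variable {A : Type*}

/-- The finite word `u_j u_{j+1} ⋯ u_{j+l-1}` read off an infinite word `u = u_0 u_1 u_2 ⋯`. -/
def slice (u : ℕ → A) (j l : ℕ) : List A :=
  (List.range l).map fun i => u (j + i)

/-- `j` is an occurrence of the finite word `w` in `u`. -/
def IsOccurrence (u : ℕ → A) (w : List A) (j : ℕ) : Prop :=
  slice u j w.length = w

/-- The language of `u`: the set of all its (finite, possibly empty) factors. -/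
def language (u : ℕ → A) : Set (List A) :=
  {w | ∃ j, IsOccurrence u w j}

/-- The factor complexity: the number of factors of `u` of length `n`
(a finite number, the alphabet being finite). -/
noncomputable def complexity (u : ℕ → A) (n : ℕ) : ℕ :=
  {w | w ∈ language u ∧ w.length = n}.ncard

/-- The return words of `w` in `u`: the words `u_j ⋯ u_{k-1}`, where `j < k` are successive
occurrences of `w` in `u`. -/
def returnWords (u : ℕ → A) (w : List A) : Set (List A) :=
  {v | ∃ j k, j < k ∧ IsOccurrence u w j ∧ IsOccurrence u w k ∧
    (∀ i, j < i → i < k → ¬ IsOccurrence u w i) ∧ v = slice u j (k - j)}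

/-- The property `R_m`: every factor of `u` has exactly `m` return words. -/
def SatisfiesR (m : ℕ) (u : ℕ → A) : Prop :=
  ∀ w ∈ language u, (returnWords u w).encard = m

/-- The left extensions of `w` in `u`. -/
def leftExtensions (u : ℕ → A) (w : List A) : Set A :=
  {a | a :: w ∈ language u}

/-- The right extensions of `w` in `u`. -/
def rightExtensions (u : ℕ → A) (w : List A) : Set A :=
  {b | w ++ [b] ∈ language u}

/-- The bilateral order
`B(w) = #{awb ∈ L(u) | a, b letters} - #E_l(w) - #E_r(w) + 1` (over a finite alphabet). -/
noncomputable def bilateralOrder (u : ℕ → A) (w : List A) : ℤ :=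
  ({x | x ∈ language u ∧ ∃ a b : A, x = a :: (w ++ [b])}.ncard : ℤ)
    - ((leftExtensions u w).ncard : ℤ) - ((rightExtensions u w).ncard : ℤ) + 1

/-- A factor is weak bispecial if its bilateral order is negative. -/
def IsWeakBispecial (u : ℕ → A) (w : List A) : Prop :=
  w ∈ language u ∧ bilateralOrder u w < 0

/-- `u` is a fixed point `σ(u) = u` of the (nonerasing) substitution `σ`: for every `n`, the
finite word `σ(u_0) σ(u_1) ⋯ σ(u_{n-1})` is a prefix of `u`. -/
def IsFixedPoint (σ : A → List A) (u : ℕ → A) : Prop :=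
  ∀ n, IsOccurrence u ((slice u 0 n).flatMap σ) 0

end General

/-- The alphabet `{1, 2, 3, 4}`. -/
inductive Letter : Type
  | l1 | l2 | l3 | l4
  deriving DecidableEq

instance : Fintype Letter where
  elems := {Letter.l1, Letter.l2, Letter.l3, Letter.l4}
  complete := by intro x; cases x <;> simp

open Letter in
/-- The substitution `1 ↦ 13231, 2 ↦ 13231424131, 3 ↦ 42324131424, 4 ↦ 42324`. -/
def sigma : Letter → List Letter
  | l1 => [l1, l3, l2, l3, l1]
  | l2 => [l1, l3, l2, l3, l1, l4, l2, l4, l1, l3, l1]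
  | l3 => [l4, l2, l3, l2, l4, l1, l3, l1, l4, l2, l4]
  | l4 => [l4, l2, l3, l2, l4]

end ReturnWords

/-! The letters of `u` alternate between the classes {1,2} and {3,4}, and `sigma` is recognisable in
a precise way. The words 132 and 423 occur only at cuts, that is, where an image begins. After a cut
the next seven letters depend only on the class of the letter desubstituted there, while the eighth
identifies that letter. Before a cut the last two letters depend only on the class of the preceding
letter, while the third from the end identifies it.

Hence the occurrences of a factor `w` of length at least 13, the one at the origin aside, correspond
to those of a shorter factor `v` (`exists_desubstitution`), and `w` has as many return words as `v`
(`encard_returnWords_eq`). By induction on length, R_4 reduces to factors of length at most 12,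
which are settled by a finite computation (`returnCheck_windows`).

The exchange 1 ↔ 4, 2 ↔ 3 commutes with `sigma` and fixes no letter, so it pairs off the factors of
each positive length and C(n) is even. Extending the image of a nonempty `v` by the two forced
letters on its left and the seven on its right preserves the bilateral order
(`exists_longer_isWeakBispecial`). Starting from the factor 1, whose order is -1, this yields
infinitely many weak bispecial factors. Since 3·2+1 is odd, parity already refutes the complexity
formula. -/

namespace ReturnWords

/-! ### Factors, occurrences and return words of an arbitrary infinite word. -/

section General

variable {A : Type*} {u : ℕ → A}

@[simp]
theorem length_slice (u : ℕ → A) (j l : ℕ) : (slice u j l).length = l := by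
  simp [slice]

@[simp]
theorem slice_zero (u : ℕ → A) (j : ℕ) : slice u j 0 = [] := rfl

theorem getElem_slice (u : ℕ → A) (j l s : ℕ) (h : s < (slice u j l).length) :
    (slice u j l)[s] = u (j + s) := by
  simp [slice]

theorem slice_eq_slice_iff {j l j' l' : ℕ} :
    slice u j l = slice u j' l' ↔ l = l' ∧ ∀ s < l, u (j + s) = u (j' + s) := by
  constructor
  · intro h
    have hl : l = l' := by simpa using congrArg List.length h
    subst hl
    refine ⟨rfl, fun s hs => ?_⟩
    rw [← getElem_slice u j l s (by simpa), ← getElem_slice u j' l s (by simpa)]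
    simp only [h]
  · rintro ⟨rfl, h⟩
    exact List.map_congr_left fun s hs => h s (List.mem_range.1 hs)

theorem slice_add (u : ℕ → A) (j a b : ℕ) :
    slice u j (a + b) = slice u j a ++ slice u (j + a) b := by
  simp [slice, List.range_add, Function.comp_def, add_assoc]

theorem slice_succ (u : ℕ → A) (j l : ℕ) : slice u j (l + 1) = slice u j l ++ [u (j + l)] := by
  rw [slice_add]; rfl

theorem slice_succ' (u : ℕ → A) (j l : ℕ) : slice u j (l + 1) = u j :: slice u (j + 1) l := by
  rw [add_comm l, slice_add]; rfl

theorem isOccurrence_slice_iff {j j' l : ℕ} :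
    IsOccurrence u (slice u j' l) j ↔ ∀ s < l, u (j + s) = u (j' + s) := by
  simp [IsOccurrence, slice_eq_slice_iff]

theorem isOccurrence_slice (u : ℕ → A) (j l : ℕ) : IsOccurrence u (slice u j l) j :=
  isOccurrence_slice_iff.2 fun _ _ => rfl

theorem slice_mem_language (u : ℕ → A) (j l : ℕ) : slice u j l ∈ language u :=
  ⟨j, isOccurrence_slice u j l⟩

theorem isOccurrence_append {x y : List A} {j : ℕ} :
    IsOccurrence u (x ++ y) j ↔ IsOccurrence u x j ∧ IsOccurrence u y (j + x.length) := by
  simp only [IsOccurrence, List.length_append, slice_add]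
  exact ⟨fun h => List.append_inj h (by simp), fun h => by rw [h.1, h.2]⟩

theorem isOccurrence_singleton {a : A} {j : ℕ} : IsOccurrence u [a] j ↔ u j = a := by
  simp [IsOccurrence, slice]

theorem isOccurrence_cons {a : A} {x : List A} {j : ℕ} :
    IsOccurrence u (a :: x) j ↔ u j = a ∧ IsOccurrence u x (j + 1) := by
  rw [← List.singleton_append, isOccurrence_append, isOccurrence_singleton]; rfl

theorem IsOccurrence.getElem {w : List A} {j s : ℕ} (h : IsOccurrence u w j)
    (hs : s < w.length) : u (j + s) = w[s] := by
  rw [← getElem_slice u j w.length s (by simpa)]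
  simp only [show slice u j w.length = w from h]

theorem mem_language_of_infix {w x : List A} (hw : w ∈ language u) (h : x <:+: w) :
    x ∈ language u := by
  obtain ⟨j, hj⟩ := hw
  obtain ⟨s, t, rfl⟩ := h
  rw [isOccurrence_append, isOccurrence_append] at hj
  exact ⟨_, hj.1.2⟩

/-- Every factor of `u` occurs arbitrarily far to the right. -/
def IsRecurrent (u : ℕ → A) : Prop :=
  ∀ w ∈ language u, ∀ N, ∃ j, N ≤ j ∧ IsOccurrence u w j

/-- `j < k` are successive occurrences of `w` in `u`. -/
def Successive (u : ℕ → A) (w : List A) (j k : ℕ) : Prop :=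
  j < k ∧ IsOccurrence u w j ∧ IsOccurrence u w k ∧ ∀ i, j < i → i < k → ¬ IsOccurrence u w i

theorem Successive.of_agree {w : List A} {j k j' : ℕ} (h : Successive u w j k)
    (hj : ∀ s < k - j + w.length, u (j' + s) = u (j + s)) :
    Successive u w j' (j' + (k - j)) := by
  obtain ⟨hjk, h1, h2, h3⟩ := h
  have key : ∀ t ≤ k - j, IsOccurrence u w (j' + t) ↔ IsOccurrence u w (j + t) := by
    intro t ht
    have : slice u (j' + t) w.length = slice u (j + t) w.length :=
      slice_eq_slice_iff.2 ⟨rfl, fun s hs => by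
        rw [add_assoc, add_assoc]; exact hj _ (by omega)⟩
    simp only [IsOccurrence, this]
  refine ⟨by omega, ?_, ?_, ?_⟩
  · simpa using (key 0 (by omega)).2 (by simpa using h1)
  · exact (key _ le_rfl).2 (by rwa [show j + (k - j) = k by omega])
  · intro i hi hi'
    obtain ⟨t, rfl⟩ := Nat.exists_eq_add_of_lt hi
    rw [add_assoc, key _ (by omega)]
    exact h3 _ (by omega) (by omega)

theorem returnWords_eq_image (u : ℕ → A) (w : List A) :
    returnWords u w = (fun p : ℕ × ℕ => slice u p.1 (p.2 - p.1)) ''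
      {p | Successive u w p.1 p.2} := by
  ext v
  constructor
  · rintro ⟨j, k, h1, h2, h3, h4, rfl⟩
    exact ⟨(j, k), ⟨h1, h2, h3, h4⟩, rfl⟩
  · rintro ⟨⟨j, k⟩, ⟨h1, h2, h3, h4⟩, rfl⟩
    exact ⟨j, k, h1, h2, h3, h4, rfl⟩

/-- Recurrence makes every pair of successive occurrences reappear beyond `N`, so boundary effects
near the origin can be ignored. -/
theorem IsRecurrent.returnWords_eq (hr : IsRecurrent u) (w : List A) (N : ℕ) :
    returnWords u w = (fun p : ℕ × ℕ => slice u p.1 (p.2 - p.1)) ''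
      {p | Successive u w p.1 p.2 ∧ N ≤ p.1} := by
  rw [returnWords_eq_image]
  refine Set.Subset.antisymm ?_ (Set.image_mono fun p hp => hp.1)
  rintro _ ⟨⟨j, k⟩, h, rfl⟩
  obtain ⟨j', hN, hj'⟩ := hr _ (slice_mem_language u j (k - j + w.length)) N
  rw [isOccurrence_slice_iff] at hj'
  refine ⟨(j', j' + (k - j)), ⟨h.of_agree hj', hN⟩, ?_⟩
  exact slice_eq_slice_iff.2 ⟨by simp, fun s hs => hj' s (by simp at hs; omega)⟩

/-- Counting principle behind both transfers, of return words and of bilateral orders: maps that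
identify the same points have equinumerous images. -/
theorem encard_image_eq_of_forall_iff {P B C : Type*} (S : Set P) (f : P → B) (g : P → C)
    (h : ∀ p ∈ S, ∀ q ∈ S, f p = f q ↔ g p = g q) : (f '' S).encard = (g '' S).encard := by
  rcases S.eq_empty_or_nonempty with rfl | ⟨p₀, -⟩
  · simp
  have : Nonempty P := ⟨p₀⟩
  have hex : ∀ b ∈ f '' S, ∃ p ∈ S, f p = b := fun b hb => hb
  choose! r hrS hr using hex
  have hinj : Set.InjOn (fun b => g (r b)) (f '' S) := fun b hb c hc hbc => by
    rw [← hr b hb, ← hr c hc]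
    exact (h _ (hrS b hb) _ (hrS c hc)).2 hbc
  rw [← hinj.encard_image]
  congr 1
  ext c
  constructor
  · rintro ⟨b, hb, rfl⟩
    exact ⟨_, hrS b hb, rfl⟩
  · rintro ⟨p, hp, rfl⟩
    have hb : f p ∈ f '' S := ⟨p, hp, rfl⟩
    exact ⟨f p, hb, (h _ (hrS _ hb) _ hp).1 (hr _ hb)⟩

theorem language_finite [Finite A] (u : ℕ → A) (n : ℕ) :
    {w | w ∈ language u ∧ w.length = n}.Finite :=
  (List.finite_length_eq A n).subset fun _ hw => hw.2

/-- The letters surrounding the occurrences of `w` in `u` other than the initial one. -/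
def extensionPairs (u : ℕ → A) (w : List A) : Set (A × A) :=
  {p | ∃ i, IsOccurrence u w (i + 1) ∧ p = (u i, u (i + 1 + w.length))}

/-- Expresses the order through one set of pairs and its two projections. Recurrence supplies a left
neighbour for each right extension, which might otherwise be seen only at the origin. -/
theorem bilateralOrder_eq (hr : IsRecurrent u) (w : List A) :
    bilateralOrder u w = ((extensionPairs u w).ncard : ℤ)
      - ((Prod.fst '' extensionPairs u w).ncard : ℤ)
      - ((Prod.snd '' extensionPairs u w).ncard : ℤ) + 1 := by
  have hboth : {x | x ∈ language u ∧ ∃ a b : A, x = a :: (w ++ [b])}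
      = (fun p : A × A => p.1 :: (w ++ [p.2])) '' extensionPairs u w := by
    ext x
    constructor
    · rintro ⟨⟨i, hi⟩, a, b, rfl⟩
      rw [isOccurrence_cons, isOccurrence_append, isOccurrence_singleton] at hi
      exact ⟨(a, b), ⟨i, hi.2.1, by rw [hi.1, hi.2.2]⟩, rfl⟩
    · rintro ⟨_, ⟨i, hi, rfl⟩, rfl⟩
      refine ⟨⟨i, ?_⟩, _, _, rfl⟩
      rw [isOccurrence_cons, isOccurrence_append, isOccurrence_singleton]
      exact ⟨rfl, hi, rfl⟩
  have hinj : Function.Injective fun p : A × A => p.1 :: (w ++ [p.2]) := by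
    rintro ⟨a, b⟩ ⟨c, d⟩ h
    simpa using h
  have hleft : leftExtensions u w = Prod.fst '' extensionPairs u w := by
    ext a
    constructor
    · rintro ⟨i, hi⟩
      rw [isOccurrence_cons] at hi
      exact ⟨_, ⟨i, hi.2, rfl⟩, hi.1⟩
    · rintro ⟨_, ⟨i, hi, rfl⟩, rfl⟩
      exact ⟨i, isOccurrence_cons.2 ⟨rfl, hi⟩⟩
  have hright : rightExtensions u w = Prod.snd '' extensionPairs u w := by
    ext b
    constructor
    · intro hb
      obtain ⟨j, hj, hj'⟩ := hr _ hb 1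
      obtain ⟨i, rfl⟩ := Nat.exists_eq_add_of_le' hj
      rw [isOccurrence_append, isOccurrence_singleton] at hj'
      exact ⟨_, ⟨i, hj'.1, rfl⟩, hj'.2⟩
    · rintro ⟨_, ⟨i, hi, rfl⟩, rfl⟩
      exact ⟨i + 1, by rw [isOccurrence_append, isOccurrence_singleton]; exact ⟨hi, rfl⟩⟩
  rw [bilateralOrder, hboth, Set.ncard_image_of_injective _ hinj, hleft, hright]

end General

/-! ### The substitution on finite words, letter classes and cut positions. -/

/-- The action of `sigma` on finite words. -/
def subst (x : List Letter) : List Letter := x.flatMap sigma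

theorem subst_append (x y : List Letter) : subst (x ++ y) = subst x ++ subst y := by
  simp [subst]

@[simp]
theorem subst_singleton (a : Letter) : subst [a] = sigma a := by simp [subst]

theorem five_le_length_sigma (a : Letter) : 5 ≤ (sigma a).length := by cases a <;> decide

theorem length_sigma_le (a : Letter) : (sigma a).length ≤ 11 := by cases a <;> decide

theorem five_mul_length_le (x : List Letter) : 5 * x.length ≤ (subst x).length := by
  induction x with
  | nil => simp
  | cons a x ih =>
    rw [← List.singleton_append, subst_append, subst_singleton]
    have := five_le_length_sigma a
    simp only [List.length_append, List.length_singleton]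
    omega

theorem le_length_iterate_subst (n : ℕ) : n < (subst^[n] [Letter.l1]).length := by
  induction n with
  | zero => simp
  | succ n ih =>
    rw [Function.iterate_succ_apply']
    have := five_mul_length_le (subst^[n] [Letter.l1])
    omega

theorem subst_infix {x y : List Letter} (h : x <:+: y) : subst x <:+: subst y := by
  obtain ⟨s, t, rfl⟩ := h
  exact ⟨subst s, subst t, by simp [subst_append]⟩

theorem subst_prefix {x y : List Letter} (h : x <+: y) : subst x <+: subst y := by
  obtain ⟨t, rfl⟩ := h
  exact ⟨subst t, by simp [subst_append]⟩

/-- The two classes of letters, `{1, 2}` and `{3, 4}`, alternate in the fixed point. -/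
def isLow : Letter → Bool
  | .l1 | .l2 => true
  | .l3 | .l4 => false

/-- The position in `u` of the image of the letter `u n`. -/
def pos (u : ℕ → Letter) (n : ℕ) : ℕ := (subst (slice u 0 n)).length

variable {u : ℕ → Letter}

@[simp]
theorem pos_zero (u : ℕ → Letter) : pos u 0 = 0 := rfl

theorem pos_succ (u : ℕ → Letter) (n : ℕ) : pos u (n + 1) = pos u n + (sigma (u n)).length := by
  simp [pos, slice_succ, subst_append]

theorem pos_add_five_le (u : ℕ → Letter) (n : ℕ) : pos u n + 5 ≤ pos u (n + 1) := by
  have := five_le_length_sigma (u n)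
  rw [pos_succ]
  omega

theorem pos_strictMono (u : ℕ → Letter) : StrictMono (pos u) :=
  strictMono_nat_of_lt_succ fun n => by have := pos_add_five_le u n; omega

theorem pos_add_five_mul_le (u : ℕ → Letter) (n l : ℕ) : pos u n + 5 * l ≤ pos u (n + l) := by
  induction l with
  | zero => simp
  | succ l ih =>
    have := pos_add_five_le u (n + l)
    rw [← add_assoc]
    omega

theorem five_mul_le_pos (u : ℕ → Letter) (n : ℕ) : 5 * n ≤ pos u n := by
  simpa using pos_add_five_mul_le u 0 n

theorem exists_pos_add (u : ℕ → Letter) (j : ℕ) :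
    ∃ i t, t < (sigma (u i)).length ∧ j = pos u i + t := by
  induction j with
  | zero => exact ⟨0, 0, by have := five_le_length_sigma (u 0); omega, rfl⟩
  | succ j ih =>
    obtain ⟨i, t, ht, rfl⟩ := ih
    by_cases h : t + 1 < (sigma (u i)).length
    · exact ⟨i, t + 1, h, rfl⟩
    · refine ⟨i + 1, 0, by have := five_le_length_sigma (u (i + 1)); omega, ?_⟩
      rw [pos_succ]
      omega

theorem pos_add_eq_of_agree {i i' l : ℕ} (h : ∀ t < l, u (i + t) = u (i' + t)) :
    pos u (i + l) + pos u i' = pos u (i' + l) + pos u i := by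
  induction l with
  | zero => simp [add_comm]
  | succ l ih =>
    have h1 := ih fun t ht => h t (by omega)
    rw [← add_assoc, ← add_assoc, pos_succ, pos_succ, h l (by omega)]
    omega

theorem isOccurrence_subst (hu : IsFixedPoint sigma u)
    {x : List Letter} {j : ℕ} (h : IsOccurrence u x j) :
    IsOccurrence u (subst x) (pos u j) := by
  have h1 := hu (j + x.length)
  rw [slice_add, zero_add, show slice u j x.length = x from h] at h1
  change IsOccurrence u (subst (_ ++ _)) 0 at h1
  rw [subst_append, isOccurrence_append, zero_add] at h1
  exact h1.2

theorem slice_pos (hu : IsFixedPoint sigma u) (i l : ℕ) (hl : l ≤ 10) :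
    slice u (pos u i) l = (sigma (u i) ++ sigma (u (i + 1))).take l := by
  have h := isOccurrence_subst hu (isOccurrence_slice u i 2)
  have h2 : subst (slice u i 2) = sigma (u i) ++ sigma (u (i + 1)) := by
    simp [slice, subst, List.range_succ]
  rw [h2] at h
  have h3 := five_le_length_sigma (u i)
  have h4 := five_le_length_sigma (u (i + 1))
  rw [← show slice u (pos u i) _ = _ from h, List.length_append,
    show (sigma (u i)).length + (sigma (u (i + 1))).length =
      l + ((sigma (u i)).length + (sigma (u (i + 1))).length - l) by omega, slice_add,
    List.take_left' (by simp)]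

theorem slice_pos_add (hu : IsFixedPoint sigma u)
    (i t l : ℕ) (h : t + l ≤ (sigma (u i)).length + 5) :
    slice u (pos u i + t) l = ((sigma (u i) ++ sigma (u (i + 1))).drop t).take l := by
  have h' := isOccurrence_subst hu (isOccurrence_slice u i 2)
  have h2 : subst (slice u i 2) = sigma (u i) ++ sigma (u (i + 1)) := by
    simp [slice, subst, List.range_succ]
  rw [h2] at h'
  have h4 := five_le_length_sigma (u (i + 1))
  rw [← show slice u (pos u i) _ = _ from h', List.length_append,
    show (sigma (u i)).length + (sigma (u (i + 1))).length =
      t + (l + ((sigma (u i)).length + (sigma (u (i + 1))).length - (t + l))) by omega, slice_add,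
    List.drop_left' (by simp), slice_add, List.take_left' (by simp)]

theorem apply_pos_add (hu : IsFixedPoint sigma u) (i t : ℕ) (ht : t < (sigma (u i)).length) :
    (sigma (u i))[t]? = some (u (pos u i + t)) := by
  have h := isOccurrence_subst hu (isOccurrence_singleton.2 (rfl : u i = u i))
  rw [subst_singleton] at h
  rw [h.getElem ht, List.getElem?_eq_getElem ht]

/-- Classes alternate inside each image, and an image begins and ends in the class of its letter.
Across a cut the claim thus reduces to the two desubstituted letters, which sit at an earlier
position. -/
theorem isLow_succ (hu : IsFixedPoint sigma u) (j : ℕ) : isLow (u (j + 1)) = !isLow (u j) := by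
  induction j using Nat.strong_induction_on with
  | _ j ih =>
    obtain ⟨i, t, ht, rfl⟩ := exists_pos_add u j
    have h11 := length_sigma_le (u i)
    have h1 := apply_pos_add hu i t ht
    by_cases h : t + 1 < (sigma (u i)).length
    · have h2 := apply_pos_add hu i (t + 1) h
      have key : ∀ a, ∀ t < 11, ∀ x y, (sigma a)[t]? = some x → (sigma a)[t + 1]? = some y →
          isLow y = !isLow x := by decide
      exact key _ t (by omega) _ _ h1 h2
    · have h2 := apply_pos_add hu (i + 1) 0 (by have := five_le_length_sigma (u (i + 1)); omega)
      rw [pos_succ, add_zero, show (sigma (u i)).length = t + 1 by omega, ← add_assoc] at h2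
      have h5 := five_le_length_sigma (u i)
      have h6 := five_mul_le_pos u i
      have h7 := ih i (by omega)
      have key : ∀ a, ∀ x, (sigma a)[0]? = some x → isLow x = isLow a := by decide
      have key' : ∀ a, ∀ x, (sigma a)[(sigma a).length - 1]? = some x → isLow x = isLow a := by
        decide
      rw [show t = (sigma (u i)).length - 1 by omega] at h1
      rw [key _ _ h2, h7, ← key' _ _ h1, show t = (sigma (u i)).length - 1 by omega]

theorem isLow_add (hu : IsFixedPoint sigma u) {i i' : ℕ} (h : isLow (u i) = isLow (u i')) (t : ℕ) :
    isLow (u (i + t)) = isLow (u (i' + t)) := by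
  induction t with
  | zero => exact h
  | succ t ih => rw [← add_assoc, ← add_assoc, isLow_succ hu, isLow_succ hu, ih]

theorem isLow_pred (hu : IsFixedPoint sigma u)
    {i i' : ℕ} (h : isLow (u (i + 1)) = isLow (u (i' + 1))) :
    isLow (u i) = isLow (u i') := by
  rw [isLow_succ hu, isLow_succ hu] at h
  simpa using h

/-! ### Recognisability of cuts and letters. -/

/-- Cuts are recognised by the three letters that follow them. -/
theorem exists_pos_eq (hu : IsFixedPoint sigma u)
    {i j : ℕ} (h : slice u j 3 = slice u (pos u i) 3) :
    ∃ i', pos u i' = j ∧ isLow (u i') = isLow (u i) := by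
  obtain ⟨k, t, ht, rfl⟩ := exists_pos_add u j
  have h11 := length_sigma_le (u k)
  rw [slice_pos_add hu k t 3 (by omega), slice_pos hu i 3 (by omega),
    List.take_append_of_le_length (by have := five_le_length_sigma (u i); omega)] at h
  have key : ∀ a b, isLow b = !isLow a → ∀ c, ∀ t < 11, t < (sigma a).length →
      ((sigma a ++ sigma b).drop t).take 3 = (sigma c).take 3 → t = 0 ∧ isLow a = isLow c := by
    decide +kernel
  obtain ⟨rfl, h'⟩ := key _ _ (isLow_succ hu k) _ t (by omega) ht h
  exact ⟨k, rfl, h'⟩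

/-- A letter is recognised by the first eight letters following the beginning of its image. -/
theorem eq_of_slice_pos_eq (hu : IsFixedPoint sigma u)
    {i i' : ℕ} (h : slice u (pos u i) 8 = slice u (pos u i') 8) :
    u i = u i' := by
  rw [slice_pos hu _ _ (by omega), slice_pos hu _ _ (by omega)] at h
  have key : ∀ a b, isLow b = !isLow a → ∀ c d, isLow d = !isLow c →
      (sigma a ++ sigma b).take 8 = (sigma c ++ sigma d).take 8 → a = c := by decide +kernel
  exact key _ _ (isLow_succ hu i) _ _ (isLow_succ hu i') h

/-- These letters are 1323142 or 4232413. After the five common letters, the last two come from the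
long image itself or from the next image, which is of the opposite class. -/
theorem slice_pos_seven (hu : IsFixedPoint sigma u) {i i' : ℕ} (h : isLow (u i) = isLow (u i')) :
    slice u (pos u i) 7 = slice u (pos u i') 7 := by
  rw [slice_pos hu _ _ (by omega), slice_pos hu _ _ (by omega)]
  have key : ∀ a b, isLow b = !isLow a → ∀ c d, isLow d = !isLow c → isLow a = isLow c →
      (sigma a ++ sigma b).take 7 = (sigma c ++ sigma d).take 7 := by decide +kernel
  exact key _ _ (isLow_succ hu i) _ _ (isLow_succ hu i') h

theorem apply_of_add_eq_pos_succ (hu : IsFixedPoint sigma u)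
    {i j r : ℕ} (h : j + (r + 1) = pos u (i + 1))
    (hr : r < (sigma (u i)).length) : (sigma (u i)).reverse[r]? = some (u j) := by
  rw [List.getElem?_reverse hr, apply_pos_add hu _ _ (by omega)]
  rw [pos_succ] at h
  congr 2
  omega

/-- Images of low letters end in 31 and those of high letters in 24. -/
theorem apply_eq_of_isLow_eq (hu : IsFixedPoint sigma u)
    {i i' j j' r : ℕ} (hr : r < 2) (h : j + (r + 1) = pos u (i + 1))
    (h' : j' + (r + 1) = pos u (i' + 1)) (hl : isLow (u i) = isLow (u i')) : u j = u j' := by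
  have h1 := apply_of_add_eq_pos_succ hu h (by have := five_le_length_sigma (u i); omega)
  have h2 := apply_of_add_eq_pos_succ hu h' (by have := five_le_length_sigma (u i'); omega)
  have key : ∀ r < 2, ∀ a b, isLow a = isLow b → (sigma a).reverse[r]? = (sigma b).reverse[r]? := by
    decide
  rw [key r hr _ _ hl, h2] at h1
  exact (Option.some_injective _ h1).symm

/-- A letter is recognised by the antepenultimate letter of its image. -/
theorem apply_eq_iff_of_add_three (hu : IsFixedPoint sigma u)
    {i i' j j' : ℕ} (h : j + 3 = pos u (i + 1))
    (h' : j' + 3 = pos u (i' + 1)) (hl : isLow (u i) = isLow (u i')) :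
    u j = u j' ↔ u i = u i' := by
  have h1 := apply_of_add_eq_pos_succ hu (r := 2) h
    (by have := five_le_length_sigma (u i); omega)
  have h2 := apply_of_add_eq_pos_succ hu (r := 2) h'
    (by have := five_le_length_sigma (u i'); omega)
  have key : ∀ a b, isLow a = isLow b →
      ((sigma a).reverse[2]? = (sigma b).reverse[2]? ↔ a = b) := by decide
  rw [← key _ _ hl, h1, h2, Option.some_inj]

/-- A letter is recognised by the eighth letter following the beginning of its image. -/
theorem apply_pos_add_seven_iff (hu : IsFixedPoint sigma u)
    {i i' : ℕ} (hl : isLow (u i) = isLow (u i')) :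
    u (pos u i + 7) = u (pos u i' + 7) ↔ u i = u i' := by
  constructor
  · intro h
    refine eq_of_slice_pos_eq hu ?_
    rw [slice_succ _ _ 7, slice_succ _ _ 7, slice_pos_seven hu hl, h]
  · intro h
    have h1 := slice_pos hu i 8 (by omega)
    have h2 := slice_pos hu i' 8 (by omega)
    have key : ∀ a b, isLow b = !isLow a → ∀ d, isLow d = !isLow a →
        (sigma a ++ sigma b).take 8 = (sigma a ++ sigma d).take 8 := by decide +kernel
    have h3 := isLow_succ hu i'
    rw [← h] at h3
    rw [key _ _ (isLow_succ hu i) _ h3, h, ← h2] at h1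
    exact (slice_eq_slice_iff.1 h1).2 7 (by omega)

/-- Desubstitution of a run of letters. -/
theorem apply_add_eq_of_agree (hu : IsFixedPoint sigma u) {i i' N : ℕ}
    (h : ∀ s < N, u (pos u i + s) = u (pos u i' + s)) (l : ℕ)
    (hl : ∀ t < l, pos u (i + t) + 8 ≤ pos u i + N) :
    (∀ t < l, u (i + t) = u (i' + t)) ∧ pos u (i + l) + pos u i' = pos u (i' + l) + pos u i := by
  induction l with
  | zero => simp [add_comm]
  | succ l ih =>
    obtain ⟨h1, h2⟩ := ih fun t ht => hl t (by omega)
    have h3 := hl l (by omega)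
    have h4 := (pos_strictMono u).monotone (show i ≤ i + l by omega)
    have h5 : u (i + l) = u (i' + l) := by
      refine eq_of_slice_pos_eq hu (slice_eq_slice_iff.2 ⟨rfl, fun s hs => ?_⟩)
      have := h (pos u (i + l) - pos u i + s) (by omega)
      rwa [show pos u i + (pos u (i + l) - pos u i + s) = pos u (i + l) + s by omega,
        show pos u i' + (pos u (i + l) - pos u i + s) = pos u (i' + l) + s by omega] at this
    refine ⟨fun t ht => ?_, ?_⟩
    · rcases Nat.lt_succ_iff_lt_or_eq.1 ht with ht | rfl
      · exact h1 t ht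
      · exact h5
    · rw [← add_assoc, ← add_assoc, pos_succ, pos_succ, h5]
      omega

/-- Substitution of a run of letters, together with the part of the next image
that only depends on its class. -/
theorem agree_of_apply_add_eq (hu : IsFixedPoint sigma u)
    {i i' l : ℕ} (h : ∀ t < l, u (i + t) = u (i' + t))
    (hlow : isLow (u i) = isLow (u i')) {s : ℕ} (hs : pos u i + s < pos u (i + l) + 7) :
    u (pos u i + s) = u (pos u i' + s) := by
  by_cases hsl : pos u i + s < pos u (i + l)
  · have h1 : slice u i l = slice u i' l := slice_eq_slice_iff.2 ⟨rfl, h⟩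
    have h2 := isOccurrence_subst hu (isOccurrence_slice u i l)
    have h3 := isOccurrence_subst hu (isOccurrence_slice u i' l)
    rw [← h1] at h3
    have h4 : pos u (i + l) = pos u i + (subst (slice u i l)).length := by
      simp only [pos, slice_add, subst_append, List.length_append, zero_add]
    rw [h2.getElem (by omega), h3.getElem (by omega)]
  · have h1 := pos_add_eq_of_agree h
    have h2 := slice_pos_seven hu (isLow_add hu hlow l)
    have h3 := (slice_eq_slice_iff.1 h2).2 (pos u i + s - pos u (i + l)) (by omega)
    rwa [show pos u (i + l) + (pos u i + s - pos u (i + l)) = pos u i + s by omega,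
      show pos u (i' + l) + (pos u i + s - pos u (i + l)) = pos u i' + s by omega] at h3

/-! ### Desubstitution of long factors. -/

/-- Occurrences of a factor with a recognisable cut correspond to occurrences of
its desubstitution. -/
theorem isOccurrence_iff_of_cut (hu : IsFixedPoint sigma u) {j₀ i₀ q n l ε : ℕ}
    (hcut : pos u (i₀ + ε) = j₀ + q) (hqn : q + 3 ≤ n)
    (hl : ∀ t < l, pos u (i₀ + ε + t) + 8 ≤ j₀ + n) (hn : j₀ + n ≤ pos u (i₀ + ε + l) + 7)
    (hε : ε = 0 ∧ q ≤ 2 ∧ 1 ≤ l ∧ 1 ≤ j₀ ∨ ε = 1 ∧ 3 ≤ q ∧ q ≤ (sigma (u i₀)).length)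
    {j : ℕ} (hj : 1 ≤ j) :
    IsOccurrence u (slice u j₀ n) j ↔
      ∃ h, IsOccurrence u (slice u i₀ (l + ε)) h ∧ pos u (h + ε) = j + q := by
  simp only [isOccurrence_slice_iff]
  constructor
  · intro h
    obtain ⟨i', hi', hlow⟩ := exists_pos_eq hu (i := i₀ + ε) (j := j + q)
      (slice_eq_slice_iff.2 ⟨rfl, fun s hs => by
        rw [hcut, add_assoc, add_assoc]; exact h _ (by omega)⟩)
    have h1 := (apply_add_eq_of_agree hu (i := i₀ + ε) (i' := i') (N := n - q)
      (fun s hs => by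
        rw [hcut, hi', add_assoc, add_assoc]; exact (h _ (by omega)).symm) l
      (fun t ht => by have := hl t ht; omega)).1
    rcases hε with ⟨rfl, -⟩ | ⟨rfl, hq, -⟩
    · exact ⟨i', fun s hs => (h1 s hs).symm, hi'⟩
    · have hi0 : i' ≠ 0 := by
        rintro rfl
        simp at hi'
        omega
      obtain ⟨k, rfl⟩ := Nat.exists_eq_succ_of_ne_zero hi0
      refine ⟨k, fun s hs => ?_, hi'⟩
      rcases s with _ | s
      -- As `q ≥ 3`, the antepenultimate letter before the cut lies inside the factor and identifies
      -- the letter preceding the cut.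
      · refine (apply_eq_iff_of_add_three hu (j := j + (q - 3)) (j' := j₀ + (q - 3)) ?_ ?_
          (isLow_pred hu hlow)).1 (h _ (by omega))
        · change _ = pos u k.succ
          omega
        · omega
      · have := h1 s (by omega)
        rw [Nat.succ_eq_add_one, add_assoc, add_assoc, add_comm 1] at this
        exact this.symm
  · rintro ⟨k, hk, hpos⟩ s hs
    have hlow : isLow (u (i₀ + ε)) = isLow (u (k + ε)) := by
      rcases hε with ⟨rfl, -, hl1, -⟩ | ⟨rfl, -⟩
      · exact congrArg isLow (hk 0 (by omega)).symm
      · rw [isLow_succ hu, isLow_succ hu]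
        exact congrArg (fun a => !isLow a) (hk 0 (by omega)).symm
    by_cases hsq : q ≤ s
    · have := agree_of_apply_add_eq hu (i := i₀ + ε) (i' := k + ε) (l := l) (s := s - q)
        (fun t ht => by
          rw [add_assoc, add_assoc]; exact (hk _ (by omega)).symm) hlow (by omega)
      rw [hcut, hpos, show j₀ + q + (s - q) = j₀ + s by omega,
        show j + q + (s - q) = j + s by omega] at this
      exact this.symm
    -- Left of the cut there are either at most two letters, fixed by the class, or a suffix of the
    -- image of the first letter of the desubstituted word.
    · rcases hε with ⟨rfl, hq, -, hj0⟩ | ⟨rfl, -, hq⟩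
      · have hk0 : k ≠ 0 := by
          rintro rfl
          simp at hpos
          omega
        have hi0 : i₀ ≠ 0 := by
          rintro rfl
          simp at hcut
          omega
        obtain ⟨k, rfl⟩ := Nat.exists_eq_succ_of_ne_zero hk0
        obtain ⟨i₀, rfl⟩ := Nat.exists_eq_succ_of_ne_zero hi0
        simp only [add_zero, Nat.succ_eq_add_one] at *
        exact apply_eq_of_isLow_eq hu (r := q - s - 1) (by omega) (by omega) (by omega)
          (isLow_pred hu hlow).symm
      · have hki : u k = u i₀ := hk 0 (by omega)
        have h1 := apply_of_add_eq_pos_succ hu (i := i₀) (j := j₀ + s) (r := q - s - 1)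
          (by omega) (by omega)
        have h2 := apply_of_add_eq_pos_succ hu (i := k) (j := j + s) (r := q - s - 1)
          (by omega) (by rw [hki]; omega)
        rw [hki, h1] at h2
        exact (Option.some_injective _ h2).symm

/-- Every factor of length at least `13` desubstitutes to a shorter one. -/
theorem exists_desubstitution (hu : IsFixedPoint sigma u) (hr : IsRecurrent u) {w : List Letter}
    (hw : w ∈ language u) (hlen : 13 ≤ w.length) :
    ∃ v ∈ language u, v ≠ [] ∧ v.length < w.length ∧ ∃ q ε, q + 3 ≤ w.length ∧ ε ≤ 1 ∧
      ∀ j, 1 ≤ j → (IsOccurrence u w j ↔ ∃ h, IsOccurrence u v h ∧ pos u (h + ε) = j + q) := by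
  obtain ⟨j₀, hj₀, hocc⟩ := hr w hw 1
  have hex : ∃ i, j₀ ≤ pos u i := ⟨j₀, by have := five_mul_le_pos u j₀; omega⟩
  obtain ⟨i₁, hi₁, hmin⟩ : ∃ i, j₀ ≤ pos u i ∧ ∀ k < i, pos u k < j₀ :=
    ⟨Nat.find hex, Nat.find_spec hex, fun k hk => not_le.1 (Nat.find_min hex hk)⟩
  -- Here `i₁` is the first cut at or after `j₀`, and `l` counts the letters recognised from it:
  -- those with at least eight letters of `w` from the start of their image on.
  have hex' : ∃ l, j₀ + w.length ≤ pos u (i₁ + l) + 7 :=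
    ⟨w.length, by have := pos_add_five_mul_le u i₁ w.length; omega⟩
  obtain ⟨l, hl, hlmin⟩ : ∃ l, j₀ + w.length ≤ pos u (i₁ + l) + 7 ∧
      ∀ t < l, pos u (i₁ + t) + 8 ≤ j₀ + w.length :=
    ⟨Nat.find hex', Nat.find_spec hex', fun k hk => by have := Nat.find_min hex' hk; omega⟩
  have hi0 : i₁ ≠ 0 := by
    rintro rfl
    simp at hi₁
    omega
  obtain ⟨i₀, rfl⟩ := Nat.exists_eq_succ_of_ne_zero hi0
  have h11 := length_sigma_le (u i₀)
  have hprev := hmin i₀ (Nat.lt_succ_self _)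
  have hsucc := pos_succ u i₀
  rw [Nat.succ_eq_add_one] at *
  obtain ⟨q, hq⟩ := Nat.exists_eq_add_of_le hi₁
  have hlw : 5 * l + q + 3 ≤ w.length ∨ l = 0 := by
    rcases l with _ | l
    · exact Or.inr rfl
    · have := hlmin l (by omega)
      have := pos_add_five_mul_le u (i₀ + 1) l
      omega
  rw [← show slice u j₀ w.length = w from hocc] at *
  generalize w.length = n at *
  simp only [length_slice] at *
  -- Images have at most 11 letters, so the first cut is at most 10 letters into the factor.
  -- Recognising it takes three more, whence the bound 13.
  by_cases hq2 : q ≤ 2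
  · have hl1 : 1 ≤ l := by
      rcases l with _ | l
      · simp only [add_zero] at hl
        omega
      · omega
    refine ⟨slice u (i₀ + 1) l, slice_mem_language .., ?_, ?_, q, 0, by omega, by omega,
      fun j hj => ?_⟩
    · rw [← List.length_pos_iff_ne_nil, length_slice]
      omega
    · rw [length_slice]
      omega
    · exact isOccurrence_iff_of_cut hu (i₀ := i₀ + 1) (ε := 0) hq (by omega) hlmin hl
        (Or.inl ⟨rfl, hq2, hl1, hj₀⟩) hj
  · refine ⟨slice u i₀ (l + 1), slice_mem_language .., ?_, ?_, q, 1, by omega, by omega,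
      fun j hj => ?_⟩
    · rw [← List.length_pos_iff_ne_nil, length_slice]
      omega
    · rw [length_slice]
      omega
    · exact isOccurrence_iff_of_cut hu (i₀ := i₀) (ε := 1) hq (by omega) hlmin hl
        (Or.inr ⟨rfl, by omega, by omega⟩) hj

/-! ### Transfer of return words. -/

/-- A factor and its desubstitution have the same number of return words. -/
theorem encard_returnWords_eq (hu : IsFixedPoint sigma u) (hr : IsRecurrent u)
    {v w : List Letter} {q ε : ℕ} (hv : v ≠ []) (hq : q + 3 ≤ w.length) (hε : ε ≤ 1)
    (H : ∀ j, 1 ≤ j → (IsOccurrence u w j ↔ ∃ h, IsOccurrence u v h ∧ pos u (h + ε) = j + q)) :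
    (returnWords u w).encard = (returnWords u v).encard := by
  have hv' := List.length_pos_iff_ne_nil.2 hv
  have hmono := pos_strictMono u
  rw [hr.returnWords_eq v (q + 1), hr.returnWords_eq w 1]
  have hpos : ∀ h, q + 1 ≤ h → q + 1 ≤ pos u (h + ε) := fun h hh => by
    have := five_mul_le_pos u (h + ε)
    omega
  have hset : (fun p : ℕ × ℕ => slice u p.1 (p.2 - p.1)) ''
      {p | Successive u w p.1 p.2 ∧ 1 ≤ p.1} =
      (fun p : ℕ × ℕ => slice u (pos u (p.1 + ε) - q) (pos u (p.2 + ε) - pos u (p.1 + ε))) ''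
      {p | Successive u v p.1 p.2 ∧ q + 1 ≤ pos u (p.1 + ε)} := by
    ext x
    constructor
    · rintro ⟨⟨j, k⟩, ⟨⟨hjk, hj, hk, hno⟩, hj1⟩, rfl⟩
      dsimp only at *
      obtain ⟨h, hh, hh'⟩ := (H j hj1).1 hj
      obtain ⟨g, hg, hg'⟩ := (H k (by omega)).1 hk
      have hhg : h + ε < g + ε := hmono.lt_iff_lt.1 (by omega)
      refine ⟨(h, g), ⟨⟨by omega, hh, hg, fun i hi hi' hocc => ?_⟩, by dsimp only; omega⟩, ?_⟩
      · dsimp only at hi hi'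
        have h1 := hmono (show h + ε < i + ε by omega)
        have h2 := hmono (show i + ε < g + ε by omega)
        exact hno (pos u (i + ε) - q) (by omega) (by omega)
          ((H _ (by omega)).2 ⟨i, hocc, by omega⟩)
      · dsimp only
        rw [show pos u (h + ε) - q = j by omega,
          show pos u (g + ε) - pos u (h + ε) = k - j by omega]
    · rintro ⟨⟨h, g⟩, ⟨⟨hhg, hh, hg, hno⟩, h1⟩, rfl⟩
      dsimp only at *
      have h2 := hmono (show h + ε < g + ε by omega)
      refine ⟨(pos u (h + ε) - q, pos u (g + ε) - q),
        ⟨⟨?_, ?_, ?_, fun i hi hi' hocc => ?_⟩, ?_⟩, ?_⟩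
      · dsimp only; omega
      · exact (H _ (by omega)).2 ⟨h, hh, by omega⟩
      · exact (H _ (by dsimp only; omega)).2 ⟨g, hg, by dsimp only; omega⟩
      · dsimp only at hi hi'
        obtain ⟨f, hf, hf'⟩ := (H i (by omega)).1 hocc
        have h3 : h + ε < f + ε := hmono.lt_iff_lt.1 (by omega)
        have h4 : f + ε < g + ε := hmono.lt_iff_lt.1 (by omega)
        exact hno f (by omega) (by omega) hf
      · dsimp only; omega
      · dsimp only
        congr 1
        omega
  rw [hset, ← hr.returnWords_eq v (q + 1)]
  -- This index set lies between the pairs starting beyond `q` and all pairs; by recurrence both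
  -- give the same return words.
  have hset' : returnWords u v = (fun p : ℕ × ℕ => slice u p.1 (p.2 - p.1)) ''
      {p | Successive u v p.1 p.2 ∧ q + 1 ≤ pos u (p.1 + ε)} := by
    refine Set.Subset.antisymm ?_ ?_
    · rw [hr.returnWords_eq v (q + 1)]
      exact Set.image_mono fun p hp => ⟨hp.1, hpos _ hp.2⟩
    · rw [returnWords_eq_image]
      exact Set.image_mono fun p hp => hp.1
  rw [hset']
  refine encard_image_eq_of_forall_iff _ _ _ ?_
  rintro ⟨h, g⟩ ⟨⟨hhg, hh, hg, -⟩, hq1⟩ ⟨h', g'⟩ ⟨⟨hhg', hh', hg', -⟩, hq1'⟩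
  dsimp only at *
  have hw : ∀ a, q + 1 ≤ pos u (a + ε) → IsOccurrence u v a →
      slice u (pos u (a + ε) - q) w.length = w := fun a ha hav =>
    (H _ (by omega)).2 ⟨a, hav, by omega⟩
  have hposg := hmono (show h + ε < g + ε by omega)
  have hposg' := hmono (show h' + ε < g' + ε by omega)
  -- When `ε = 1` this letter precedes the first cut, so it is read off `v` and not recovered from
  -- what follows the cut.
  have hfirst : u h = u h' := by
    have h1 := hh.getElem hv'
    have h2 := hh'.getElem hv'
    rw [add_zero] at h1 h2
    rw [h1, h2]
  have hww := slice_eq_slice_iff.1 ((hw h hq1 hh).trans (hw h' hq1' hh').symm)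
  have hww' := slice_eq_slice_iff.1 ((hw g (by omega) hg).trans (hw g' (by omega) hg').symm)
  rw [slice_eq_slice_iff, slice_eq_slice_iff]
  constructor
  · rintro ⟨hlen, hs⟩
    -- The copy of `w` after the return word adds three known letters beyond the last cut. With the
    -- at least five letters of the last image they make the eight needed to recognise it.
    obtain ⟨h1, h2⟩ := apply_add_eq_of_agree hu (i := h + ε) (i' := h' + ε)
      (N := pos u (g + ε) - pos u (h + ε) + 3) (fun s hs' => by
        by_cases hsl : q + s < pos u (g + ε) - pos u (h + ε)
        · have := hs (q + s) hsl
          rwa [show pos u (h + ε) - q + (q + s) = pos u (h + ε) + s by omega,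
            show pos u (h' + ε) - q + (q + s) = pos u (h' + ε) + s by omega] at this
        · have := hww'.2 (q + s - (pos u (g + ε) - pos u (h + ε))) (by omega)
          rwa [show pos u (g + ε) - q + (q + s - (pos u (g + ε) - pos u (h + ε))) =
              pos u (h + ε) + s by omega,
            show pos u (g' + ε) - q + (q + s - (pos u (g + ε) - pos u (h + ε))) =
              pos u (h' + ε) + s by omega] at this) (g - h)
      (fun t ht => by
        have h1 := pos_add_five_le u (h + ε + t)
        have h2 := hmono.monotone (show h + ε + t + 1 ≤ g + ε by omega)
        omega)
    rw [show h + ε + (g - h) = g + ε by omega] at h2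
    have h3 := hmono.injective (show pos u (h' + ε + (g - h)) = pos u (g' + ε) by omega)
    refine ⟨by omega, fun s hs' => ?_⟩
    rcases Nat.lt_or_ge s ε with hsε | hsε
    · obtain rfl : s = 0 := by omega
      exact hfirst
    · have := h1 (s - ε) (by omega)
      rwa [show h + ε + (s - ε) = h + s by omega,
        show h' + ε + (s - ε) = h' + s by omega] at this
  · rintro ⟨hlen, hs⟩
    have hlast : u g = u g' := by
      have h1 := hg.getElem hv'
      have h2 := hg'.getElem hv'
      rw [add_zero] at h1 h2
      rw [h1, h2]
    have hrun : ∀ t < g - h, u (h + ε + t) = u (h' + ε + t) := fun t ht => by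
      by_cases htl : ε + t < g - h
      · rw [add_assoc, add_assoc]
        exact hs _ htl
      · rwa [show h + ε + t = g by omega, show h' + ε + t = g' by omega]
    have h2 := pos_add_eq_of_agree hrun
    rw [show h + ε + (g - h) = g + ε by omega, show h' + ε + (g - h) = g' + ε by omega] at h2
    refine ⟨by omega, fun s hs' => ?_⟩
    by_cases hsq : s < q
    · exact hww.2 s (by omega)
    · have h3 := agree_of_apply_add_eq hu hrun (congrArg isLow (hrun 0 (by omega)))
        (s := s - q) (by rw [show h + ε + (g - h) = g + ε by omega]; omega)
      rwa [show pos u (h + ε) + (s - q) = pos u (h + ε) - q + s by omega,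
        show pos u (h' + ε) + (s - q) = pos u (h' + ε) - q + s by omega] at h3

/-! ### The finite computation for short factors. -/

/-- Equality test for letters, in a form that the kernel evaluates quickly. -/
def sameLetter : Letter → Letter → Bool
  | .l1, .l1 => true
  | .l2, .l2 => true
  | .l3, .l3 => true
  | .l4, .l4 => true
  | _, _ => false

theorem sameLetter_iff (a b : Letter) : sameLetter a b = true ↔ a = b := by
  cases a <;> cases b <;> decide

/-- Prefix test, in a form that the kernel evaluates quickly. -/
noncomputable def prefixTest (x : List Letter) : List Letter → Bool :=
  List.rec (fun _ => true)
    (fun a _ ih y => List.rec false (fun b y' _ => Bool.rec false (ih y') (sameLetter a b)) y) x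

theorem prefixTest_iff (x y : List Letter) : prefixTest x y = true ↔ x <+: y := by
  induction x generalizing y with
  | nil => simp [prefixTest]
  | cons a x ih =>
    cases y with
    | nil => simp [prefixTest]
    | cons b y =>
      rw [List.cons_prefix_cons, ← ih, ← sameLetter_iff]
      change (Bool.rec false (prefixTest x y) (sameLetter a b) : Bool) = true ↔ _
      cases sameLetter a b <;> simp

/-- The initial part of a word up to the next occurrence of `w`, if there is one. -/
noncomputable def untilNext (w z : List Letter) : Option (List Letter) :=
  List.rec none (fun a z ih =>
    Bool.rec (Option.rec none (fun r => some (a :: r)) ih) (some [a]) (prefixTest w z)) z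

theorem untilNext_cons (w : List Letter) (a : Letter) (z : List Letter) :
    untilNext w (a :: z) =
      if prefixTest w z then some [a] else (untilNext w z).map (a :: ·) := by
  change (Bool.rec (Option.rec none (fun r => some (a :: r)) (untilNext w z)) (some [a])
    (prefixTest w z) : Option (List Letter)) = _
  cases prefixTest w z <;> cases untilNext w z <;> rfl

/-- The search starts at position `j + 1`; if `w` also occurs at `j`, the result is the return word
read there. -/
theorem untilNext_spec {w r : List Letter} {j m : ℕ}
    (h : untilNext w (slice u j m) = some r) :
    r.length + w.length ≤ m ∧ 0 < r.length ∧ r = slice u j r.length ∧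
      IsOccurrence u w (j + r.length) ∧
      ∀ i, j < i → i < j + r.length → ¬ IsOccurrence u w i := by
  induction m generalizing j r with
  | zero => simp [untilNext] at h
  | succ m ih =>
    rw [slice_succ', untilNext_cons] at h
    split_ifs at h with hp
    · obtain rfl : [u j] = r := by simpa using h
      rw [prefixTest_iff] at hp
      have hle : w.length ≤ m := by simpa using hp.length_le
      refine ⟨by simp; omega, by simp, rfl, ?_, fun i hi hi' => by simp at hi'; omega⟩
      obtain ⟨t, ht⟩ := hp
      exact (isOccurrence_append.1 (ht ▸ isOccurrence_slice u (j + 1) m :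
        IsOccurrence u (w ++ t) (j + 1))).1
    · obtain ⟨r', hr', rfl⟩ := Option.map_eq_some_iff.1 h
      obtain ⟨h1, h2, h3, h4, h5⟩ := ih hr'
      simp only [List.length_cons]
      refine ⟨by omega, by omega, ?_, ?_, fun i hi hi' => ?_⟩
      · rw [slice_succ', ← h3]
      · rwa [add_comm r'.length, ← add_assoc]
      · rcases (show j + 1 ≤ i from hi).eq_or_lt with rfl | hlt
        · intro hocc
          refine hp ((prefixTest_iff _ _).2 ?_)
          rw [← show slice u (j + 1) w.length = w from hocc,
            show m = w.length + (m - w.length) by omega, slice_add]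
          exact List.prefix_append _ _
        · exact h5 i hlt (by omega)

/-- The list of the words `untilNext w z`, without repetitions, if all of them exist. -/
noncomputable def nextList (w : List Letter) : List (List Letter) → Option (List (List Letter))
  | [] => some []
  | z :: Z => match untilNext w z, nextList w Z with
    | some r, some R => some (R.insert r)
    | _, _ => none

theorem nextList_spec {w : List Letter} {Z R : List (List Letter)} (h : nextList w Z = some R) :
    R.Nodup ∧ (∀ r, r ∈ R ↔ ∃ z ∈ Z, untilNext w z = some r) ∧
      ∀ z ∈ Z, ∃ r, untilNext w z = some r := by
  induction Z generalizing R with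
  | nil =>
    obtain rfl : [] = R := by simpa [nextList] using h
    simp
  | cons z Z ih =>
    rw [nextList] at h
    split at h
    · rename_i r R' hr hR'
      obtain rfl : R'.insert r = R := by simpa using h
      obtain ⟨h1, h2, h3⟩ := ih hR'
      refine ⟨h1.insert, fun s => ?_, ?_⟩
      · rw [List.mem_insert_iff, h2]
        simp [hr, eq_comm]
      · simp only [List.mem_cons, forall_eq_or_imp]
        exact ⟨⟨r, hr⟩, h3⟩
    · simp at h

def hasLengthFour : Option (List (List Letter)) → Bool
  | some [_, _, _, _] => true
  | _ => false

theorem hasLengthFour_iff (R : Option (List (List Letter))) :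
    hasLengthFour R = true ↔ ∃ R', R = some R' ∧ R'.length = 4 := by
  rcases R with _ | R
  · simp [hasLengthFour]
  · rcases R with _ | ⟨a, _ | ⟨b, _ | ⟨c, _ | ⟨d, _ | ⟨e, R⟩⟩⟩⟩⟩ <;> simp [hasLengthFour]

/-- Counts the return words of all words that extend `w` by at most `f` letters
and are prefixes of a word of `Z`. -/
noncomputable def returnCheck : ℕ → List Letter → List (List Letter) → Bool
  | 0, w, Z => Z.isEmpty || hasLengthFour (nextList w Z)
  | f + 1, w, Z => Z.isEmpty || (hasLengthFour (nextList w Z) &&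
      [Letter.l1, .l2, .l3, .l4].all fun a =>
        returnCheck f (w ++ [a]) (Z.filter (prefixTest (w ++ [a]))))

/-- The check walks down the tree of words one letter at a time; the successive filters collapse to
the filter by the whole word. -/
theorem returnCheck_spec {f : ℕ} {w : List Letter} {Z : List (List Letter)}
    (h : returnCheck f w Z = true) (hZ : ∀ z ∈ Z, w <+: z) (x : List Letter) (hx : x.length ≤ f)
    (hne : ∃ z ∈ Z, w ++ x <+: z) :
    hasLengthFour (nextList (w ++ x) (Z.filter (prefixTest (w ++ x)))) = true := by
  induction f generalizing w Z x with
  | zero =>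
    obtain rfl : x = [] := by simpa using hx
    obtain ⟨z, hz, -⟩ := hne
    rw [List.append_nil, List.filter_eq_self.2 fun z hz => (prefixTest_iff _ _).2 (hZ z hz)]
    simpa [returnCheck, List.ne_nil_of_mem hz] using h
  | succ f ih =>
    obtain ⟨z, hz, hzx⟩ := hne
    simp only [returnCheck, Bool.or_eq_true, List.isEmpty_iff, List.ne_nil_of_mem hz, false_or,
      Bool.and_eq_true, List.all_eq_true] at h
    rcases x with _ | ⟨a, x⟩
    · rw [List.append_nil, List.filter_eq_self.2 fun z hz => (prefixTest_iff _ _).2 (hZ z hz)]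
      exact h.1
    · have hwx : w ++ a :: x = (w ++ [a]) ++ x := by simp
      rw [hwx] at hzx ⊢
      have h1 := ih (h.2 a (by cases a <;> simp))
        (fun z hz => (prefixTest_iff _ _).1 (List.mem_filter.1 hz).2) x (by simpa using hx)
        ⟨z, List.mem_filter.2 ⟨hz, (prefixTest_iff _ _).2
          ((List.prefix_append _ _).trans hzx)⟩, hzx⟩
      rw [List.filter_filter] at h1
      convert h1 using 3
      congr 1
      funext y
      rw [Bool.eq_iff_iff, Bool.and_eq_true, prefixTest_iff, prefixTest_iff]
      exact ⟨fun hy => ⟨hy, (List.prefix_append _ _).trans hy⟩, fun hy => hy.1⟩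

/-- The factors of length `4` of the fixed point. -/
def fourFactors : List (List Letter) :=
  (([[.l1, .l3], [.l1, .l4], [.l2, .l3], [.l2, .l4], [.l3, .l1], [.l3, .l2], [.l4, .l1],
    [.l4, .l2]] : List (List Letter)).flatMap fun x =>
      (List.range 11).map fun t => ((subst x).drop t).take 4).dedup.filter (·.length == 4)

/-- The words read in the fixed point from a position in the double image of the first letter
of a factor of length `4` to the end of the double image of this factor. -/
def windows : List (List Letter) :=
  fourFactors.flatMap fun x =>
    (subst (subst x)).tails.take (subst (subst (x.take 1))).length

/-- Success also certifies that the windows are long enough: `nextList` fails as soon as the word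
does not reappear within some window. -/
theorem returnCheck_windows : returnCheck 12 [] windows = true := by decide +kernel

theorem slice_four_mem (hu : IsFixedPoint sigma u) (j : ℕ) : slice u j 4 ∈ fourFactors := by
  obtain ⟨i, t, ht, rfl⟩ := exists_pos_add u j
  have h11 := length_sigma_le (u i)
  rw [slice_pos_add hu i t 4 (by omega)]
  have key : ∀ a b, isLow b = !isLow a → ∀ t < 11, t < (sigma a).length →
      ((sigma a ++ sigma b).drop t).take 4 ∈ fourFactors := by decide +kernel
  exact key _ _ (isLow_succ hu i) t (by omega) ht

theorem pos_add_length {x : List Letter} {j : ℕ} (h : IsOccurrence u x j) :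
    pos u (j + x.length) = pos u j + (subst x).length := by
  rw [pos, slice_add, zero_add, subst_append, List.length_append,
    show slice u j x.length = x from h]
  rfl

theorem exists_window (hu : IsFixedPoint sigma u) (j : ℕ) :
    ∃ z ∈ windows, IsOccurrence u z j := by
  -- Desubstituting the position twice puts it in the double image of `u i`; the window comes from
  -- the four letters starting at `i`.
  obtain ⟨k, t, ht, rfl⟩ := exists_pos_add u j
  obtain ⟨i, s, hs, rfl⟩ := exists_pos_add u k
  have hmono := (pos_strictMono u).monotone
  have h1 := hmono (show pos u i ≤ pos u i + s by omega)
  have h2 := hmono (show pos u i + s + 1 ≤ pos u i + (sigma (u i)).length by omega)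
  have h3 := pos_succ u (pos u i + s)
  have h4 : IsOccurrence u (sigma (u i)) (pos u i) := by
    rw [← subst_singleton]
    exact isOccurrence_subst hu (isOccurrence_singleton.2 rfl)
  rw [pos_add_length h4] at h2
  have h5 := isOccurrence_subst hu (isOccurrence_subst hu (isOccurrence_slice u i 4))
  have h6 : (slice u i 4).take 1 = [u i] := rfl
  have h7 : (subst (sigma (u i))).length ≤ (subst (subst (slice u i 4))).length := by
    rw [slice_succ' u i 3, ← List.singleton_append, subst_append, subst_append, subst_singleton,
      List.length_append]
    omega
  refine ⟨(subst (subst (slice u i 4))).drop (pos u (pos u i + s) + t - pos u (pos u i)),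
    List.mem_flatMap.2 ⟨_, slice_four_mem hu i, List.mem_take_iff_getElem.2
      ⟨_, ?_, List.getElem_tails _ _ _⟩⟩, ?_⟩
  · rw [h6, subst_singleton, List.length_tails]
    omega
  · rw [← List.take_append_drop (pos u (pos u i + s) + t - pos u (pos u i))
      (subst (subst (slice u i 4))), isOccurrence_append, List.length_take_of_le (by omega)] at h5
    rw [show pos u (pos u i + s) + t =
      pos u (pos u i) + (pos u (pos u i + s) + t - pos u (pos u i)) by omega]
    convert h5.2 using 2
    congr 1
    omega

theorem isOccurrence_iterate_subst (hu : IsFixedPoint sigma u) (h0 : u 0 = .l1) (n : ℕ) :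
    IsOccurrence u (subst^[n] [.l1]) 0 := by
  induction n with
  | zero => exact isOccurrence_singleton.2 h0
  | succ n ih =>
    rw [Function.iterate_succ_apply']
    exact isOccurrence_subst hu ih

theorem mem_language_of_mem_windows (hu : IsFixedPoint sigma u) (h0 : u 0 = .l1)
    {z : List Letter} (hz : z ∈ windows) : z ∈ language u := by
  obtain ⟨x, hx, hz⟩ := List.mem_flatMap.1 hz
  have hsuff := (List.mem_tails _ _).1 (List.mem_of_mem_take hz)
  -- Hence every window lies in the fifth iterate on the letter 1.
  have key : ∀ x ∈ fourFactors, x <:+: subst^[3] [.l1] := by decide +kernel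
  exact mem_language_of_infix ⟨0, isOccurrence_iterate_subst hu h0 5⟩
    (hsuff.isInfix.trans (subst_infix (subst_infix (key x hx))))

theorem encard_returnWords_of_length_le (hu : IsFixedPoint sigma u) (h0 : u 0 = .l1)
    {w : List Letter} (hw : w ∈ language u) (hlen : w.length ≤ 12) :
    (returnWords u w).encard = 4 := by
  have hpre : ∀ z ∈ windows, 12 ≤ z.length := by decide +kernel
  have hwin : ∀ j, IsOccurrence u w j → ∃ z ∈ windows, IsOccurrence u z j ∧ w <+: z := by
    intro j hj
    obtain ⟨z, hz, hzj⟩ := exists_window hu j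
    refine ⟨z, hz, hzj, ?_⟩
    have := hpre z hz
    rw [← show slice u j w.length = w from hj, ← show slice u j z.length = z from hzj,
      show z.length = w.length + (z.length - w.length) by omega, slice_add]
    exact List.prefix_append _ _
  have hne : ∃ z ∈ windows, w <+: z := by
    obtain ⟨j, hj⟩ := hw
    obtain ⟨z, hz, -, hwz⟩ := hwin j hj
    exact ⟨z, hz, hwz⟩
  have h1 := returnCheck_spec returnCheck_windows (fun z _ => List.nil_prefix) w hlen hne
  rw [List.nil_append, hasLengthFour_iff] at h1
  obtain ⟨R, hR, hR4⟩ := h1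
  obtain ⟨h2, h3, h4⟩ := nextList_spec hR
  have hset : returnWords u w = (R.toFinset : Set (List Letter)) := by
    ext r
    rw [Finset.mem_coe, List.mem_toFinset, h3, returnWords_eq_image]
    constructor
    · rintro ⟨⟨j, k⟩, ⟨hjk, hj, hk, hno⟩, rfl⟩
      dsimp only at *
      obtain ⟨z, hz, hzj, hwz⟩ := hwin j hj
      have hz' := List.mem_filter.2 ⟨hz, (prefixTest_iff w z).2 hwz⟩
      obtain ⟨r, hr⟩ := h4 z hz'
      refine ⟨z, hz', ?_⟩
      rw [hr]
      rw [← show slice u j z.length = z from hzj] at hr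
      obtain ⟨-, h5, h6, h7, h8⟩ := untilNext_spec hr
      have h9 : j + r.length = k := by
        by_contra hne
        rcases Nat.lt_or_gt_of_ne hne with hlt | hlt
        · exact hno _ (by omega) hlt h7
        · exact h8 k hjk hlt hk
      rw [← h9, Nat.add_sub_cancel_left, ← h6]
    · rintro ⟨z, hz, hr⟩
      rw [List.mem_filter, prefixTest_iff] at hz
      obtain ⟨j, hj⟩ := mem_language_of_mem_windows hu h0 hz.1
      rw [← show slice u j z.length = z from hj] at hr
      obtain ⟨-, h5, h6, h7, h8⟩ := untilNext_spec hr
      obtain ⟨t, ht⟩ := hz.2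
      rw [← ht, isOccurrence_append] at hj
      refine ⟨(j, j + r.length), ⟨by dsimp only; omega, hj.1, h7, h8⟩, ?_⟩
      dsimp only
      rw [Nat.add_sub_cancel_left, ← h6]
  rw [hset, Set.encard_coe_eq_coe_finsetCard, List.toFinset_card_of_nodup h2, hR4]
  rfl

/-! ### Recurrence and the property R_4. -/

theorem exists_infix_iterate_subst (hu : IsFixedPoint sigma u) (h0 : u 0 = .l1)
    {w : List Letter} (hw : w ∈ language u) : ∃ n, w <:+: subst^[n] [.l1] := by
  obtain ⟨j, hj⟩ := hw
  refine ⟨j + w.length, ?_⟩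
  have hlen := le_length_iterate_subst (j + w.length)
  rw [← show slice u 0 _ = _ from isOccurrence_iterate_subst hu h0 (j + w.length),
    show (subst^[j + w.length] [Letter.l1]).length = j + w.length +
      ((subst^[j + w.length] [Letter.l1]).length - (j + w.length)) by omega,
    slice_add, slice_add, zero_add, show slice u j w.length = w from hj]
  exact ⟨_, _, rfl⟩

theorem exists_isOccurrence_iterate_subst (hu : IsFixedPoint sigma u) {x : List Letter} {j : ℕ}
    (h : IsOccurrence u x j) (n : ℕ) : ∃ k, j ≤ k ∧ IsOccurrence u (subst^[n] x) k := by
  induction n with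
  | zero => exact ⟨j, le_rfl, h⟩
  | succ n ih =>
    obtain ⟨k, hjk, hk⟩ := ih
    have := five_mul_le_pos u k
    rw [Function.iterate_succ_apply']
    exact ⟨pos u k, by omega, isOccurrence_subst hu hk⟩

theorem apply_pos_of_isLow (hu : IsFixedPoint sigma u) (i : ℕ) :
    u (pos u i) = if isLow (u i) then .l1 else .l4 := by
  have h := apply_pos_add hu i 0 (by have := five_le_length_sigma (u i); omega)
  have key : ∀ a, (sigma a)[0]? = some (if isLow a then .l1 else .l4) := by decide
  rw [key] at h
  exact (Option.some_injective _ h).symm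

/-- Every factor lies in an iterated image of 1. The letter 1 starts the image of each low letter,
hence occurs arbitrarily far, and substituting never moves an occurrence to the left. -/
theorem isRecurrent (hu : IsFixedPoint sigma u) (h0 : u 0 = .l1) : IsRecurrent u := by
  intro w hw N
  obtain ⟨n, s, t, hn⟩ := exists_infix_iterate_subst hu h0 hw
  obtain ⟨j, hj, hj1⟩ : ∃ j, N ≤ j ∧ u j = .l1 := by
    have h1 := five_mul_le_pos u N
    have h2 := five_mul_le_pos u (N + 1)
    by_cases h : isLow (u N) = true
    · exact ⟨pos u N, by omega, by rw [apply_pos_of_isLow hu, if_pos h]⟩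
    · refine ⟨pos u (N + 1), by omega, ?_⟩
      rw [apply_pos_of_isLow hu, isLow_succ hu, if_pos (by simpa using h)]
  obtain ⟨k, hk, hocc⟩ := exists_isOccurrence_iterate_subst hu (isOccurrence_singleton.2 hj1) n
  rw [← hn, isOccurrence_append, isOccurrence_append] at hocc
  exact ⟨_, by omega, hocc.1.2⟩

theorem satisfiesR_four (hu : IsFixedPoint sigma u) (h0 : u 0 = .l1) : SatisfiesR 4 u := by
  intro w
  induction hn : w.length using Nat.strong_induction_on generalizing w with
  | _ n ih =>
    subst hn
    intro hw
    by_cases hlen : w.length ≤ 12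
    · exact encard_returnWords_of_length_le hu h0 hw hlen
    · obtain ⟨v, hv, hne, hvw, q, ε, hq, hε, H⟩ :=
        exists_desubstitution hu (isRecurrent hu h0) hw (by omega)
      rw [encard_returnWords_eq hu (isRecurrent hu h0) hne hq hε H]
      exact ih _ hvw v rfl hv

/-! ### The letter symmetry and the parity of the complexity. -/

/-- The exchange `1 ↔ 4`, `2 ↔ 3`. -/
def swap : Letter → Letter
  | .l1 => .l4
  | .l2 => .l3
  | .l3 => .l2
  | .l4 => .l1

theorem swap_swap (a : Letter) : swap (swap a) = a := by cases a <;> rfl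

theorem subst_map_swap (x : List Letter) : subst (x.map swap) = (subst x).map swap := by
  have key : ∀ a, sigma (swap a) = (sigma a).map swap := by decide
  simp [subst, List.flatMap_map, List.map_flatMap, key]

theorem map_swap_mem_language (hu : IsFixedPoint sigma u) (h0 : u 0 = .l1) {w : List Letter}
    (hw : w ∈ language u) : w.map swap ∈ language u := by
  obtain ⟨n, hn⟩ := exists_infix_iterate_subst hu h0 hw
  have h4 : u (pos u 1) = .l4 := by
    rw [apply_pos_of_isLow hu, isLow_succ hu, h0]
    rfl
  obtain ⟨k, -, hk⟩ := exists_isOccurrence_iterate_subst hu (isOccurrence_singleton.2 h4) n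
  refine mem_language_of_infix ⟨k, hk⟩ ?_
  have : subst^[n] [Letter.l4] = (subst^[n] [Letter.l1]).map swap :=
    (Function.Semiconj.iterate_right (f := List.map swap) (ga := subst) (gb := subst)
      (fun x => (subst_map_swap x).symm) n [Letter.l1]).symm
  rw [this]
  exact hn.map swap

theorem even_complexity (hu : IsFixedPoint sigma u) (h0 : u 0 = .l1) {n : ℕ} (hn : 1 ≤ n) :
    Even (complexity u n) := by
  have hfin := language_finite u n
  rw [complexity, Set.ncard_eq_toFinset_card _ hfin, ← ZMod.natCast_eq_zero_iff_even,
    Finset.card_eq_sum_ones, Nat.cast_sum]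
  -- The cardinality modulo 2 is a sum of ones, which cancel in pairs under the exchange.
  refine Finset.sum_involution (fun w _ => w.map swap) (fun _ _ => by decide) ?_ ?_ ?_
  · intro w hw _ heq
    rw [Set.Finite.mem_toFinset] at hw
    rcases w with _ | ⟨a, w⟩
    · simp at hw
      omega
    · have : swap a = a := (List.cons.inj heq).1
      cases a <;> simp [swap] at this
  · intro w hw
    rw [Set.Finite.mem_toFinset] at hw ⊢
    exact ⟨map_swap_mem_language hu h0 hw.1, by simpa using hw.2⟩
  · intro w _
    simp [Function.comp_def, swap_swap]

/-! ### Weak bispecial factors. -/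

/-- Two factors have the same bilateral order if their pairs of surrounding letters
are in bijection, componentwise. -/
theorem bilateralOrder_eq_of_forall_iff {A : Type*} {u : ℕ → A} (hr : IsRecurrent u)
    {v w : List A} {P : Type*} (S : Set P) (f g : P → A × A) (hf : extensionPairs u v = f '' S)
    (hg : extensionPairs u w = g '' S)
    (h1 : ∀ p ∈ S, ∀ q ∈ S, (f p).1 = (f q).1 ↔ (g p).1 = (g q).1)
    (h2 : ∀ p ∈ S, ∀ q ∈ S, (f p).2 = (f q).2 ↔ (g p).2 = (g q).2) :
    bilateralOrder u w = bilateralOrder u v := by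
  rw [bilateralOrder_eq hr, bilateralOrder_eq hr, hf, hg, Set.image_image, Set.image_image,
    Set.image_image, Set.image_image]
  simp only [Set.ncard_def]
  rw [encard_image_eq_of_forall_iff S f g fun p hp q hq => by
      rw [Prod.ext_iff, Prod.ext_iff, h1 p hp q hq, h2 p hp q hq],
    encard_image_eq_of_forall_iff S (fun p => (f p).1) (fun p => (g p).1) h1,
    encard_image_eq_of_forall_iff S (fun p => (f p).2) (fun p => (g p).2) h2]

theorem exists_longer_isWeakBispecial (hu : IsFixedPoint sigma u) (h0 : u 0 = .l1)
    {v : List Letter} (hne : 0 < v.length) (hv : IsWeakBispecial u v) :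
    ∃ w, IsWeakBispecial u w ∧ v.length < w.length := by
  have hr := isRecurrent hu h0
  obtain ⟨i₀, hi₀, hocc⟩ := hr v hv.1 1
  have h5 := five_mul_le_pos u i₀
  have hlen := pos_add_five_mul_le u i₀ v.length
  -- The new factor is the image of `v` with the two letters before it and the seven after it, hence
  -- 9. Its neighbours, at offsets -3 and +7 from the outer cuts, are the letters that identify the
  -- neighbours of `v`.
  obtain ⟨n, hn⟩ : ∃ n, n + pos u i₀ = pos u (i₀ + v.length) + 9 :=
    ⟨_, Nat.sub_add_cancel (by omega)⟩
  have H : ∀ j, 1 ≤ j → (IsOccurrence u (slice u (pos u i₀ - 2) n) j ↔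
      ∃ h, IsOccurrence u v h ∧ pos u h = j + 2) := fun j hj => by
    have := isOccurrence_iff_of_cut hu (i₀ := i₀) (j₀ := pos u i₀ - 2) (q := 2) (ε := 0) (n := n)
      (l := v.length) (by rw [add_zero]; omega) (by omega) (fun t ht => by
        have h1 := pos_add_five_le u (i₀ + t)
        have h2 := (pos_strictMono u).monotone (show i₀ + t + 1 ≤ i₀ + v.length by omega)
        rw [add_zero]
        omega) (by rw [add_zero]; omega) (Or.inl ⟨rfl, le_rfl, hne, by omega⟩) hj
    rwa [add_zero, show slice u i₀ v.length = v from hocc] at this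
  have hposn : ∀ i, IsOccurrence u v i → n + pos u i = pos u (i + v.length) + 9 := fun i hi => by
    have h1 := pos_add_length hi
    have h2 := pos_add_length hocc
    omega
  refine ⟨slice u (pos u i₀ - 2) n, ⟨slice_mem_language .., ?_⟩, by rw [length_slice]; omega⟩
  rw [bilateralOrder_eq_of_forall_iff hr {i | IsOccurrence u v (i + 1)}
    (fun i => (u i, u (i + 1 + v.length)))
    (fun i => (u (pos u (i + 1) - 3), u (pos u (i + 1 + v.length) + 7))) (v := v)]
  · exact hv.2
  · ext p
    exact ⟨fun ⟨i, hi, hp⟩ => ⟨i, hi, hp.symm⟩, fun ⟨i, hi, hp⟩ => ⟨i, hi, hp.symm⟩⟩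
  · ext p
    constructor
    · rintro ⟨k, hk, rfl⟩
      obtain ⟨h, hh, hpos⟩ := (H (k + 1) (by omega)).1 hk
      have h0 : h ≠ 0 := by
        rintro rfl
        simp at hpos
      obtain ⟨i, rfl⟩ := Nat.exists_eq_succ_of_ne_zero h0
      rw [Nat.succ_eq_add_one] at *
      have := hposn _ hh
      refine ⟨i, hh, ?_⟩
      dsimp only
      rw [length_slice, show pos u (i + 1) - 3 = k by omega,
        show pos u (i + 1 + v.length) + 7 = k + 1 + n by omega]
    · rintro ⟨i, hi, rfl⟩
      have h1 := five_mul_le_pos u (i + 1)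
      have h2 := hposn _ hi
      refine ⟨pos u (i + 1) - 3, (H _ (by omega)).2 ⟨i + 1, hi, by omega⟩, ?_⟩
      dsimp only
      rw [length_slice, show pos u (i + 1 + v.length) + 7 = pos u (i + 1) - 3 + 1 + n by omega]
  all_goals
    intro i hi i' hi'
    have h1 := (hi : IsOccurrence u v (i + 1)).getElem hne
    rw [← (hi' : IsOccurrence u v (i' + 1)).getElem hne, add_zero, add_zero] at h1
    have hlow := congrArg isLow h1
  · have h2 := five_mul_le_pos u (i + 1)
    have h3 := five_mul_le_pos u (i' + 1)
    exact (apply_eq_iff_of_add_three hu (by omega) (by omega) (isLow_pred hu hlow)).symm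
  · exact (apply_pos_add_seven_iff hu (isLow_add hu hlow _)).symm

theorem isWeakBispecial_l1 (hu : IsFixedPoint sigma u) (h0 : u 0 = .l1) :
    IsWeakBispecial u [.l1] := by
  refine ⟨⟨0, isOccurrence_singleton.2 h0⟩, ?_⟩
  have hext : extensionPairs u [.l1] = {(.l3, .l4), (.l4, .l3)} := by
    ext ⟨x, y⟩
    constructor
    · rintro ⟨j, hj, hxy⟩
      rw [isOccurrence_singleton] at hj
      obtain ⟨i, t, ht, rfl⟩ := exists_pos_add u j
      have h11 := length_sigma_le (u i)
      have h3 := slice_pos_add hu i t 3 (by omega)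
      have key : ∀ a b, isLow b = !isLow a → ∀ t < 11, t < (sigma a).length → ∀ x y,
          [x, .l1, y] = ((sigma a ++ sigma b).drop t).take 3 →
          (x, y) = (Letter.l3, Letter.l4) ∨ (x, y) = (Letter.l4, Letter.l3) := by decide +kernel
      refine key _ _ (isLow_succ hu i) t (by omega) ht _ _ (Eq.trans ?_ h3)
      rw [Prod.mk.injEq] at hxy
      rw [hxy.1, hxy.2, ← hj]
      rfl
    · intro h
      have key : ∀ x y, (x, y) = (Letter.l3, Letter.l4) ∨ (x, y) = (Letter.l4, Letter.l3) →
          [x, .l1, y] <:+: subst^[2] [.l1] := by decide +kernel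
      obtain ⟨j, hj⟩ := mem_language_of_infix ⟨0, isOccurrence_iterate_subst hu h0 2⟩ (key x y h)
      rw [isOccurrence_cons, isOccurrence_cons, isOccurrence_singleton] at hj
      exact ⟨j, isOccurrence_singleton.2 hj.2.1, by rw [← hj.1, ← hj.2.2]; rfl⟩
  rw [bilateralOrder_eq (isRecurrent hu h0), hext, Set.image_pair, Set.image_pair,
    Set.ncard_pair (by decide), Set.ncard_pair (by decide), Set.ncard_pair (by decide)]
  norm_num

theorem infinite_isWeakBispecial (hu : IsFixedPoint sigma u) (h0 : u 0 = .l1) :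
    {w : List Letter | IsWeakBispecial u w}.Infinite := by
  refine Set.Infinite.of_image List.length (Set.infinite_of_forall_exists_gt fun n => ?_)
  suffices ∃ w, IsWeakBispecial u w ∧ n < w.length by
    obtain ⟨w, hw, hn⟩ := this
    exact ⟨_, ⟨w, hw, rfl⟩, hn⟩
  induction n with
  | zero => exact ⟨_, isWeakBispecial_l1 hu h0, by simp⟩
  | succ n ih =>
    obtain ⟨v, hv, hn⟩ := ih
    obtain ⟨w, hw, hvw⟩ := exists_longer_isWeakBispecial hu h0 (by omega) hv
    exact ⟨w, hw, by omega⟩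

/-! ### Existence and uniqueness of the fixed point. -/

theorem iterate_subst_prefix {m n : ℕ} (h : m ≤ n) :
    subst^[m] [Letter.l1] <+: subst^[n] [Letter.l1] := by
  induction n, h using Nat.le_induction with
  | base => exact List.prefix_rfl
  | succ n hmn ih =>
    refine ih.trans ?_
    rw [Function.iterate_succ_apply]
    clear ih hmn
    induction n with
    | zero => decide
    | succ n ih =>
      rw [Function.iterate_succ_apply', Function.iterate_succ_apply']
      exact subst_prefix ih

theorem exists_isFixedPoint : ∃ u : ℕ → Letter, IsFixedPoint sigma u ∧ u 0 = .l1 := by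
  -- The iterates on 1 are nested prefixes, the `i`-th having more than `i` letters, so this
  -- diagonal choice is their limit.
  let u : ℕ → Letter := fun i => (subst^[i] [Letter.l1])[i]'(le_length_iterate_subst i)
  have hocc : ∀ n, IsOccurrence u (subst^[n] [.l1]) 0 := by
    intro n
    refine List.ext_getElem (by simp) fun i h1 h2 => ?_
    rw [getElem_slice, zero_add]
    rcases le_total i n with h | h
    · exact (iterate_subst_prefix h).getElem _
    · exact ((iterate_subst_prefix h).getElem _).symm
  refine ⟨u, fun n => ?_, rfl⟩
  change IsOccurrence u (subst (slice u 0 n)) 0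
  have h1 := hocc (n + 1)
  have hlen := le_length_iterate_subst n
  rw [Function.iterate_succ_apply', ← show slice u 0 _ = _ from hocc n,
    ← Nat.add_sub_cancel' hlen.le, slice_add, subst_append, isOccurrence_append] at h1
  exact h1.1

theorem IsFixedPoint.unique {u u' : ℕ → Letter} (hu : IsFixedPoint sigma u) (h0 : u 0 = .l1)
    (hu' : IsFixedPoint sigma u') (h0' : u' 0 = .l1) : u = u' := by
  funext i
  have hlen := le_length_iterate_subst i
  have h1 := (isOccurrence_iterate_subst hu h0 i).getElem hlen
  have h2 := (isOccurrence_iterate_subst hu' h0' i).getElem hlen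
  rw [zero_add] at h1 h2
  rw [h1, h2]

end ReturnWords

theorem mainTheorem5 :
    (∃! u : ℕ → ReturnWords.Letter,
      ReturnWords.IsFixedPoint ReturnWords.sigma u ∧ u 0 = ReturnWords.Letter.l1) ∧
    (∀ u : ℕ → ReturnWords.Letter,
      ReturnWords.IsFixedPoint ReturnWords.sigma u → u 0 = ReturnWords.Letter.l1 →
        ReturnWords.SatisfiesR 4 u ∧
        (∀ n : ℕ, 1 ≤ n → Even (ReturnWords.complexity u n)) ∧
        {w : List ReturnWords.Letter | ReturnWords.IsWeakBispecial u w}.Infinite ∧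
        ¬ (∀ n : ℕ, ReturnWords.complexity u n = 3 * n + 1)) ∧
    ¬ (∀ (m : ℕ) (A : Type) [Finite A] (u : ℕ → A), ReturnWords.SatisfiesR m u →
        ∀ n : ℕ, (ReturnWords.complexity u n : ℤ) = ((m : ℤ) - 1) * (n : ℤ) + 1) := by
  obtain ⟨u, hu, h0⟩ := ReturnWords.exists_isFixedPoint
  refine ⟨⟨u, ⟨hu, h0⟩, fun v hv => hv.1.unique hv.2 hu h0⟩, fun v hv hv0 =>
    ⟨ReturnWords.satisfiesR_four hv hv0, fun n hn => ReturnWords.even_complexity hv hv0 hn,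
      ReturnWords.infinite_isWeakBispecial hv hv0, fun h => ?_⟩, fun h => ?_⟩
  -- At length 2 the formula would give the odd value 7.
  · have := ReturnWords.even_complexity hv hv0 (n := 2) (by omega)
    rw [h 2] at this
    exact absurd this (by decide)
  · have h1 := h 4 _ u (ReturnWords.satisfiesR_four hu h0) 2
    have h2 := ReturnWords.even_complexity hu h0 (n := 2) (by omega)
    obtain ⟨r, hr⟩ := h2
    rw [hr] at h1
    push_cast at h1
    omega
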